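/- Let $k\ge 1$, let $A\in\mathbb{R}^{n\times d}$ have rank at least $k$, and let $0<\epsilon<\tfrac14$. For a real matrix $M$ with singular value decomposition $M=U\Sigma V^T$ (singular values in non-increasing order), write $M_k=U_k\Sigma_kV_k^T$ for the approximation that keeps the $k$ largest singular values, $M_{\backslash k}=M-M_k$, $M^+$ for the Moore–Penrose pseudoinverse, and $\|\cdot\|_F$ for the Frobenius norm. Let $$\bar\tau_i(A)=a_i^T\Big(AA^T+\tfrac1k\|A_{\backslash k}\|_F^2\,I\Big)^{+}a_i,\qquad i=1,\dots,d,$$ be the ridge leverage scores of the columns $a_i$ of $A$. Choose a set $\Theta$ of column indices deterministically as follows: sort the indices by $\bar\tau_i(A)$ from largest to smallest (ties broken arbitrarily) and add them to $\Theta$ in this order until $\sum_{i\in\Theta}\bar\tau_i(A)>\sum_{i=1}^d\bar\tau_i(A)-\epsilon$; if then $|\Theta|<k$, continue adding indices in this order until $|\Theta|=k$. Let $C$ be the submatrix of $A$ formed by the columns with index in $\Theta$. Then $(CC^+A)_k$ is a best approximation of $A$ in Frobenius norm among the matrices of rank at most $k$ whose columns lie in the column space of $C$, and $$\|A-CC^+A\|_F^2\;\le\;\|A-(CC^+A)_k\|_F^2\;\le\;(1+4\epsilon)\,\|A_{\backslash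 k}\|_F^2 .$$ These statements hold for every choice of the singular value decompositions and of the tie-breaking. -/

import Mathlib

open scoped Matrix

-- From here on `‖M‖` is the Frobenius norm of the matrix `M`.
attribute [local instance] Matrix.frobeniusNormedAddCommGroup

namespace DRLS

/-! ### Moore–Penrose pseudoinverse -/

/-- `X` is the Moore–Penrose pseudoinverse of the real matrix `A` (the four Penrose conditions). -/
structure IsMoorePenroseInverse {m n : Type*} [Fintype m] [Fintype n]
    (A : Matrix m n ℝ) (X : Matrix n m ℝ) : Prop where
  mul_mul_self : A * X * A = A
  self_mul_mul : X * A * X = X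
  symm_left : (A * X)ᵀ = A * X
  symm_right : (X * A)ᵀ = X * A

theorem IsMoorePenroseInverse.unique {m n : Type*} [Fintype m] [Fintype n]
    {A : Matrix m n ℝ} {X Y : Matrix n m ℝ}
    (hX : IsMoorePenroseInverse A X) (hY : IsMoorePenroseInverse A Y) : X = Y := by
  have h1 : A * X = A * Y := by
    calc A * X = (A * X)ᵀ := hX.symm_left.symm
      _ = ((A * Y) * (A * X))ᵀ := by rw [← Matrix.mul_assoc (A * Y) A X, hY.mul_mul_self]
      _ = (A * X) * (A * Y) := by rw [Matrix.transpose_mul, hX.symm_left, hY.symm_left]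
      _ = A * Y := by rw [← Matrix.mul_assoc, hX.mul_mul_self]
  have h2 : X * A = Y * A := by
    calc X * A = (X * A)ᵀ := hX.symm_right.symm
      _ = ((X * A) * (Y * A))ᵀ := by
          rw [Matrix.mul_assoc X A (Y * A), ← Matrix.mul_assoc A Y A, hY.mul_mul_self]
      _ = (Y * A) * (X * A) := by rw [Matrix.transpose_mul, hX.symm_right, hY.symm_right]
      _ = Y * A := by rw [Matrix.mul_assoc, ← Matrix.mul_assoc A X A, hX.mul_mul_self]
  calc X = X * A * X := hX.self_mul_mul.symm
    _ = Y * A * Y := by rw [h2, Matrix.mul_assoc, h1, ← Matrix.mul_assoc]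
    _ = Y := hY.self_mul_mul

theorem exists_isMoorePenroseInverse {m n : Type*} [Fintype m] [Fintype n]
    (A : Matrix m n ℝ) : ∃ X : Matrix n m ℝ, IsMoorePenroseInverse A X := by
  classical
  have hG : (Aᵀ * A).IsHermitian := by
    simpa using Matrix.isHermitian_conjTranspose_mul_self A
  obtain ⟨H, hHs, hGHG, hHGH, hcomm⟩ : ∃ H : Matrix n n ℝ, Hᵀ = H ∧
      (Aᵀ * A) * H * (Aᵀ * A) = Aᵀ * A ∧ H * (Aᵀ * A) * H = H ∧
      (Aᵀ * A) * H = H * (Aᵀ * A) := by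
    obtain ⟨U, l, hU, hs⟩ : ∃ (U : Matrix n n ℝ) (l : n → ℝ), Uᵀ * U = 1 ∧
        Aᵀ * A = U * Matrix.diagonal l * Uᵀ := by
      refine ⟨hG.eigenvectorUnitary, hG.eigenvalues, ?_, ?_⟩
      · have := (Matrix.mem_unitaryGroup_iff' (A := (hG.eigenvectorUnitary : Matrix n n ℝ))).1
          hG.eigenvectorUnitary.2
        simpa [Matrix.star_eq_conjTranspose] using this
      · have := hG.spectral_theorem
        rw [Unitary.conjStarAlgAut_apply] at this
        simpa [Matrix.star_eq_conjTranspose, Function.comp_def] using this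
    have key : ∀ a b : n → ℝ, (U * Matrix.diagonal a * Uᵀ) * (U * Matrix.diagonal b * Uᵀ) =
        U * Matrix.diagonal (fun i => a i * b i) * Uᵀ := by
      intro a b
      rw [← Matrix.diagonal_mul_diagonal]
      calc _ = U * Matrix.diagonal a * (Uᵀ * U) * Matrix.diagonal b * Uᵀ := by
            simp only [Matrix.mul_assoc]
        _ = _ := by rw [hU]; simp only [Matrix.mul_assoc, Matrix.mul_one]
    refine ⟨U * Matrix.diagonal (fun i => (l i)⁻¹) * Uᵀ, ?_, ?_, ?_, ?_⟩
    · simp [Matrix.transpose_mul, Matrix.mul_assoc]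
    · rw [hs, key, key]; congr; funext i; simp
    · rw [hs, key, key]; congr; funext i; by_cases h : l i = 0 <;> simp [h]
    · rw [hs, key, key]; congr; funext i; ring
  refine ⟨H * Aᵀ, ?_, ?_, ?_, ?_⟩
  · have h0 : (A * (H * Aᵀ) * A - A)ᵀ * (A * (H * Aᵀ) * A - A) = 0 := by
      have e : A * (H * Aᵀ) * A = A * (H * (Aᵀ * A)) := by simp only [Matrix.mul_assoc]
      have e1 : (A * (H * (Aᵀ * A)))ᵀ = (Aᵀ * A) * H * Aᵀ := by
        simp only [Matrix.transpose_mul, Matrix.transpose_transpose, hHs]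
      have e2 : (Aᵀ * A) * H * Aᵀ * (A * (H * (Aᵀ * A))) = Aᵀ * A := by
        calc _ = ((Aᵀ * A) * H * (Aᵀ * A)) * H * (Aᵀ * A) := by simp only [Matrix.mul_assoc]
          _ = _ := by rw [hGHG, hGHG]
      have e3 : (Aᵀ * A) * H * Aᵀ * A = Aᵀ * A := by rw [Matrix.mul_assoc, hGHG]
      have e4 : Aᵀ * (A * (H * (Aᵀ * A))) = Aᵀ * A := by
        rw [← Matrix.mul_assoc, ← Matrix.mul_assoc, hGHG]
      rw [e, Matrix.transpose_sub, e1, Matrix.sub_mul, Matrix.mul_sub, Matrix.mul_sub, e2, e3, e4]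
      simp
    have h1 : A * (H * Aᵀ) * A - A = 0 := by
      have := (Matrix.conjTranspose_mul_self_eq_zero (A := A * (H * Aᵀ) * A - A)).1
      exact this (by simpa using h0)
    exact sub_eq_zero.1 h1
  · calc H * Aᵀ * A * (H * Aᵀ) = (H * (Aᵀ * A) * H) * Aᵀ := by simp only [Matrix.mul_assoc]
      _ = _ := by rw [hHGH]
  · simp only [Matrix.transpose_mul, Matrix.transpose_transpose, hHs, Matrix.mul_assoc]
  · rw [Matrix.mul_assoc, Matrix.transpose_mul, hHs, Matrix.transpose_mul,
      Matrix.transpose_transpose, hcomm]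

/-- The Moore–Penrose pseudoinverse `A⁺` of a real matrix. -/
noncomputable def pinv {m n : Type*} [Fintype m] [Fintype n] (A : Matrix m n ℝ) :
    Matrix n m ℝ :=
  Classical.choose (exists_isMoorePenroseInverse A)

theorem pinv_spec {m n : Type*} [Fintype m] [Fintype n] (A : Matrix m n ℝ) :
    IsMoorePenroseInverse A (pinv A) :=
  Classical.choose_spec (exists_isMoorePenroseInverse A)

/-! ### Singular value decomposition and its truncation -/

/-- `A = U * S * Vᵀ` is a singular value decomposition: `U`, `V` are square orthogonal matrices and
`S` is rectangular diagonal with nonnegative, non-increasingly ordered diagonal entries. -/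
structure IsSVD {n d : ℕ} (A : Matrix (Fin n) (Fin d) ℝ) (U : Matrix (Fin n) (Fin n) ℝ)
    (S : Matrix (Fin n) (Fin d) ℝ) (V : Matrix (Fin d) (Fin d) ℝ) : Prop where
  orthogonal_left : U ∈ Matrix.orthogonalGroup (Fin n) ℝ
  orthogonal_right : V ∈ Matrix.orthogonalGroup (Fin d) ℝ
  diagonal : ∀ (i : Fin n) (j : Fin d), (i : ℕ) ≠ (j : ℕ) → S i j = 0
  nonneg : ∀ (i : Fin n) (j : Fin d), (i : ℕ) = (j : ℕ) → 0 ≤ S i j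
  antitone : ∀ (i i' : Fin n) (j j' : Fin d), (i : ℕ) = (j : ℕ) → (i' : ℕ) = (j' : ℕ) →
    i ≤ i' → S i' j' ≤ S i j
  eq_mul : A = U * S * Vᵀ

/-- Keep the first `k` diagonal entries of the rectangular diagonal matrix `S` and replace the
others by zero. -/
def truncate {n d : ℕ} (k : ℕ) (S : Matrix (Fin n) (Fin d) ℝ) : Matrix (Fin n) (Fin d) ℝ :=
  Matrix.of fun i j => if (i : ℕ) < k then S i j else 0

/-- `B` is a rank-`k` SVD approximation `A_k = U_k Σ_k V_kᵀ` of `A`: it comes from some singular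
value decomposition of `A` by keeping the `k` largest singular values with their singular vectors.
(If the `k`-th singular value is repeated, `A` can have several such approximations.) -/
def IsSVDApprox {n d : ℕ} (k : ℕ) (A B : Matrix (Fin n) (Fin d) ℝ) : Prop :=
  ∃ (U : Matrix (Fin n) (Fin n) ℝ) (S : Matrix (Fin n) (Fin d) ℝ) (V : Matrix (Fin d) (Fin d) ℝ),
    IsSVD A U S V ∧ B = U * truncate k S * Vᵀ

/-- `B` is a best approximation of `A` in Frobenius norm among the matrices of rank at most `k`
whose columns lie in the column space of `C`. -/
def IsBestApproxInColSpace {n d : ℕ} {ι : Type*} [Fintype ι] (k : ℕ) (C : Matrix (Fin n) ι ℝ)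
    (A B : Matrix (Fin n) (Fin d) ℝ) : Prop :=
  (B.rank ≤ k ∧ ∃ Y : Matrix ι (Fin d) ℝ, B = C * Y) ∧
    ∀ X : Matrix (Fin n) (Fin d) ℝ, X.rank ≤ k → (∃ Y : Matrix ι (Fin d) ℝ, X = C * Y) →
      ‖A - B‖ ≤ ‖A - X‖

/-! ### Ridge leverage scores and the deterministic column selection -/

/-- The `i`-th ridge leverage score `aᵢᵀ (A Aᵀ + lam I)⁺ aᵢ`, where `aᵢ` is the `i`-th column
of `A`. -/
noncomputable def ridgeLeverageScore {n d : ℕ} (A : Matrix (Fin n) (Fin d) ℝ) (lam : ℝ)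
    (i : Fin d) : ℝ :=
  A.col i ⬝ᵥ (pinv (A * Aᵀ + lam • (1 : Matrix (Fin n) (Fin n) ℝ)) *ᵥ A.col i)

/-- The set of the first `m` indices in the order `π 0, π 1, …`. -/
def firstIndices {d : ℕ} (π : Equiv.Perm (Fin d)) (m : ℕ) : Finset (Fin d) :=
  (Finset.univ.filter fun j : Fin d => (j : ℕ) < m).image π

/-- `Θ` is a possible output of the deterministic selection with scores `τ`, target rank `k` and
error tolerance `ε`. Sort the indices by score, from largest to smallest (`π`); add them to `Θ` in
this order until the sum of the scores in `Θ` exceeds the total score minus `ε` (this happens after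
`m` additions); if `Θ` has fewer than `k` elements, continue until it has `k` elements. -/
def IsSelection {d : ℕ} (τ : Fin d → ℝ) (k : ℕ) (ε : ℝ) (Θ : Finset (Fin d)) : Prop :=
  ∃ (π : Equiv.Perm (Fin d)) (m : ℕ),
    Antitone (τ ∘ π) ∧
    IsLeast {l : ℕ | ∑ i ∈ firstIndices π l, τ i > ∑ i, τ i - ε} m ∧
    Θ = firstIndices π (max m k)

/-- The `d × |Θ|` selection matrix; its columns are indexed by the elements of `Θ`. -/
def selectionMatrix {d : ℕ} (Θ : Finset (Fin d)) : Matrix (Fin d) Θ ℝ :=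
  Matrix.of fun i j => if i = (j : Fin d) then 1 else 0

/-- `C` is the column submatrix `A S` of `A` that the deterministic selection with ridge leverage
scores produces for rank `k` and error tolerance `ε`; its columns are indexed by `Θ`, the selected
set, and the regularization parameter is `‖A - A_k‖_F² / k`, where `Ak` is `A_k`. -/
def IsDRLS {n d : ℕ} (A Ak : Matrix (Fin n) (Fin d) ℝ) (k : ℕ) (ε : ℝ) (Θ : Finset (Fin d))
    (C : Matrix (Fin n) Θ ℝ) : Prop :=
  IsSelection (ridgeLeverageScore A (1 / (k : ℝ) * ‖A - Ak‖ ^ 2)) k ε Θ ∧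
    C = A * selectionMatrix Θ

end DRLS

/-! Write `δ = ‖A - A_k‖²`, `K = A Aᵀ + (δ/k) I`, and let `τ i` be the scores. Let `Q` project onto
the span of up to `k` top left singular vectors of `C`, a subspace of the column space of `C`
(`exists_isOrthProj_isMax`). By Ky Fan's principle `Q` loses no more of `C` than the projection onto
the columns of `A_k` does, hence at most `δ` on the selected columns.

For `x` orthogonal to the range of `Q`, split `xᵀ K x` into selected columns (at most `δ |x|²`),
discarded columns (at most `ε xᵀ K x`, since `(x ⬝ a_i)² ≤ (xᵀ K x) τ i`) and the ridge term (at
most `δ |x|²`). As `ε < 1/4`, this gives `xᵀ K x ≤ 4 δ |x|²`. Taking `x` to be the residual of a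
discarded column `a_i` bounds its squared norm by `4 δ τ i`, and the discarded scores sum to less
than `ε`. So `Q A` has squared error at most `(1 + 4ε) δ` (`norm_sub_mul_sq_le_of_selected`).

Pythagoras for `C C⁺` reduces approximation of `A` within the column space of `C` to approximation
of `C C⁺ A`, where Eckart–Young makes the truncation optimal, in particular at least as good as `Q
A`. -/

namespace DRLS

open Matrix

/-! ### The Frobenius norm and orthogonal projections -/

section Frobenius

variable {m n : Type*} [Fintype m] [Fintype n]

theorem frobenius_norm_sq (M : Matrix m n ℝ) : ‖M‖ ^ 2 = ∑ i, ∑ j, M i j ^ 2 := by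
  rw [frobenius_norm_def, ← Real.sqrt_eq_rpow, Real.sq_sqrt (by positivity)]
  simp

theorem frobenius_norm_sq_eq_trace (M : Matrix m n ℝ) : ‖M‖ ^ 2 = (M * Mᵀ).trace := by
  rw [frobenius_norm_sq]
  simp [trace, mul_apply, sq]

theorem frobenius_norm_sq_eq_sum_col (M : Matrix m n ℝ) :
    ‖M‖ ^ 2 = ∑ j, M.col j ⬝ᵥ M.col j := by
  rw [frobenius_norm_sq, Finset.sum_comm]
  simp [dotProduct, sq]

theorem frobenius_norm_sq_orthogonal_mul [DecidableEq m] [DecidableEq n] {U : Matrix m m ℝ}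
    {V : Matrix n n ℝ} (hU : Uᵀ * U = 1) (hV : Vᵀ * V = 1) (S : Matrix m n ℝ) :
    ‖U * S * Vᵀ‖ ^ 2 = ‖S‖ ^ 2 := by
  rw [frobenius_norm_sq_eq_trace, frobenius_norm_sq_eq_trace]
  calc (U * S * Vᵀ * (U * S * Vᵀ)ᵀ).trace = (U * (S * (Vᵀ * V) * Sᵀ) * Uᵀ).trace := by
        simp only [transpose_mul, transpose_transpose, Matrix.mul_assoc]
    _ = ((Uᵀ * U) * (S * Sᵀ)).trace := by
        rw [hV, Matrix.mul_one, trace_mul_comm, Matrix.mul_assoc]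
    _ = (S * Sᵀ).trace := by rw [hU, Matrix.one_mul]

end Frobenius

/-- `R` is an orthogonal projection matrix. -/
structure IsOrthProj {m : Type*} [Fintype m] (R : Matrix m m ℝ) : Prop where
  transpose_eq : Rᵀ = R
  mul_self : R * R = R

section OrthProj

variable {m n : Type*} [Fintype m] [Fintype n]

theorem IsMoorePenroseInverse.isOrthProj {A : Matrix m n ℝ} {X : Matrix n m ℝ}
    (h : IsMoorePenroseInverse A X) : IsOrthProj (A * X) :=
  ⟨h.symm_left, by rw [← Matrix.mul_assoc, h.mul_mul_self]⟩

theorem IsOrthProj.conj [DecidableEq m] {R U : Matrix m m ℝ} (hR : IsOrthProj R)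
    (hU : U * Uᵀ = 1) : IsOrthProj (Uᵀ * R * U) where
  transpose_eq := by simp [transpose_mul, hR.transpose_eq, Matrix.mul_assoc]
  mul_self := by
    calc Uᵀ * R * U * (Uᵀ * R * U) = Uᵀ * R * (U * Uᵀ) * R * U := by
          simp only [Matrix.mul_assoc]
      _ = Uᵀ * (R * R) * U := by rw [hU]; simp only [Matrix.mul_assoc, Matrix.one_mul]
      _ = _ := by rw [hR.mul_self]

/-- Symmetry and idempotence make each diagonal entry the squared norm of its row; this places the
diagonal in `[0, 1]`, as Ky Fan's argument needs. -/
theorem IsOrthProj.diag_eq {R : Matrix m m ℝ} (hR : IsOrthProj R) (i : m) :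
    R i i = ∑ j, R i j ^ 2 := by
  conv_lhs => rw [← hR.mul_self]
  rw [mul_apply]
  refine Finset.sum_congr rfl fun j _ => ?_
  rw [sq]
  congr 1
  conv_lhs => rw [← hR.transpose_eq]
  rfl

theorem IsOrthProj.diag_nonneg {R : Matrix m m ℝ} (hR : IsOrthProj R) (i : m) : 0 ≤ R i i := by
  rw [hR.diag_eq]; positivity

theorem IsOrthProj.diag_le_one {R : Matrix m m ℝ} (hR : IsOrthProj R) (i : m) : R i i ≤ 1 := by
  have h : R i i ^ 2 ≤ R i i := by
    conv_rhs => rw [hR.diag_eq]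
    exact Finset.single_le_sum (f := fun j => R i j ^ 2) (fun j _ => sq_nonneg _)
      (Finset.mem_univ i)
  nlinarith

theorem IsOrthProj.rank_eq_trace [DecidableEq m] {R : Matrix m m ℝ} (hR : IsOrthProj R) :
    (R.rank : ℝ) = R.trace := by
  have h : IsIdempotentElem (toLin' R) := by
    rw [IsIdempotentElem, Module.End.mul_eq_comp, ← toLin'_mul, hR.mul_self]
  rw [← trace_toLin'_eq, (LinearMap.IsIdempotentElem.isProj_range _ h).trace]
  rfl

theorem exists_isOrthProj_range (X : Matrix m n ℝ) :
    ∃ R : Matrix m m ℝ, IsOrthProj R ∧ R.rank ≤ X.rank ∧ R * X = X :=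
  ⟨X * pinv X, (pinv_spec X).isOrthProj, rank_mul_le_left _ _, (pinv_spec X).mul_mul_self⟩

variable [DecidableEq m]

theorem IsOrthProj.one_sub {R : Matrix m m ℝ} (hR : IsOrthProj R) : IsOrthProj (1 - R) where
  transpose_eq := by simp [hR.transpose_eq]
  mul_self := by simp [Matrix.sub_mul, Matrix.mul_sub, hR.mul_self]

theorem IsOrthProj.norm_sub_mul_sq {R : Matrix m m ℝ} (hR : IsOrthProj R) (M : Matrix m n ℝ) :
    ‖M - R * M‖ ^ 2 = (M * Mᵀ).trace - (R * (M * Mᵀ)).trace := by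
  have e : M - R * M = (1 - R) * M := by rw [Matrix.sub_mul, Matrix.one_mul]
  rw [frobenius_norm_sq_eq_trace, e]
  calc ((1 - R) * M * ((1 - R) * M)ᵀ).trace = ((1 - R) * (M * Mᵀ) * (1 - R)).trace := by
        rw [transpose_mul, hR.one_sub.transpose_eq]; simp only [Matrix.mul_assoc]
    _ = ((1 - R) * (1 - R) * (M * Mᵀ)).trace := by rw [trace_mul_comm, ← Matrix.mul_assoc]
    _ = _ := by rw [hR.one_sub.mul_self, Matrix.sub_mul, Matrix.one_mul, trace_sub]

/-- Pythagoras for a matrix `X` whose columns are fixed by the projection `R`. -/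
theorem IsOrthProj.pythagoras {R : Matrix m m ℝ} (hR : IsOrthProj R) (M X : Matrix m n ℝ)
    (hX : R * X = X) : ‖M - X‖ ^ 2 = ‖M - R * M‖ ^ 2 + ‖R * M - X‖ ^ 2 := by
  have hE : M - R * M = (1 - R) * M := by rw [Matrix.sub_mul, Matrix.one_mul]
  have hF : R * M - X = R * (M - X) := by rw [Matrix.mul_sub, hX]
  have hs : M - X = (M - R * M) + (R * M - X) := by abel
  have h0 : R * (1 - R) = 0 := by rw [Matrix.mul_sub, hR.mul_self, Matrix.mul_one, sub_self]
  have h1 : ((M - R * M) * (R * M - X)ᵀ).trace = 0 := by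
    rw [hE, hF, transpose_mul, hR.transpose_eq, ← Matrix.mul_assoc, trace_mul_comm,
      ← Matrix.mul_assoc, ← Matrix.mul_assoc, h0]
    simp
  have h2 : ((R * M - X) * (M - R * M)ᵀ).trace = 0 := by
    rw [← trace_transpose, transpose_mul, transpose_transpose, h1]
  rw [frobenius_norm_sq_eq_trace (M - X), hs, transpose_add, Matrix.add_mul, Matrix.mul_add,
    Matrix.mul_add, trace_add, trace_add, trace_add, h1, h2, ← frobenius_norm_sq_eq_trace,
    ← frobenius_norm_sq_eq_trace]
  ring

end OrthProj

/-! ### Ky Fan's maximum principle and the Eckart–Young theorem -/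

/-- In the eigenbasis the trace is a weighted sum of the `D i` with weights in `[0, 1]` of total at
most `k`; full weight on the `k` largest values is optimal. -/
theorem ky_fan_trace_le {n k : ℕ} {U R : Matrix (Fin n) (Fin n) ℝ} (hU' : U * Uᵀ = 1)
    {D : Fin n → ℝ} (hD : Antitone D) (hD0 : ∀ i, 0 ≤ D i)
    (hR : IsOrthProj R) (hk : R.rank ≤ k) :
    (R * (U * diagonal D * Uᵀ)).trace ≤ ∑ i : Fin n, if (i : ℕ) < k then D i else 0 := by
  have hW := hR.conj hU'
  set W := Uᵀ * R * U with hWdef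
  have htr : (R * (U * diagonal D * Uᵀ)).trace = ∑ i, W i i * D i := by
    rw [← Matrix.mul_assoc, trace_mul_comm, ← Matrix.mul_assoc, ← Matrix.mul_assoc, ← hWdef]
    simp [trace, mul_diagonal]
  have hsum : ∑ i, W i i ≤ k := by
    calc ∑ i, W i i = W.trace := rfl
      _ = R.trace := by
          rw [hWdef, trace_mul_comm, ← Matrix.mul_assoc, hU', Matrix.one_mul]
      _ = R.rank := hR.rank_eq_trace.symm
      _ ≤ k := by exact_mod_cast hk
  rw [htr]
  have h0 := hW.diag_nonneg
  have h1 := hW.diag_le_one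
  rcases le_or_gt n k with hnk | hkn
  · refine Finset.sum_le_sum fun i _ => ?_
    rw [if_pos (i.2.trans_le hnk)]
    nlinarith [h0 i, h1 i, hD0 i]
  -- With zero-based indices `t` is the largest value outside the first `k`. Comparing every term
  -- with this threshold leaves the slack `t * (k - trace W) ≥ 0`.
  · set t := D ⟨k, hkn⟩ with ht
    have hterm : ∀ i : Fin n, t * ((if (i : ℕ) < k then (1 : ℝ) else 0) - W i i) ≤
        (if (i : ℕ) < k then D i else 0) - W i i * D i := by
      intro i
      split_ifs with h
      · have : t ≤ D i := hD (Fin.le_def.2 h.le)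
        nlinarith [h1 i]
      · have : D i ≤ t := hD (Fin.le_def.2 (not_lt.1 h))
        nlinarith [h0 i]
    have hcard : ∑ i : Fin n, (if (i : ℕ) < k then (1 : ℝ) else 0) = k := by
      rw [Fin.sum_univ_eq_sum_range (fun i => if i < k then (1 : ℝ) else 0) n,
        ← Finset.sum_filter]
      have : (Finset.range n).filter (· < k) = Finset.range k := by
        ext i; simp only [Finset.mem_filter, Finset.mem_range]; omega
      rw [this]; simp
    have hs := Finset.sum_le_sum fun i (_ : i ∈ Finset.univ) => hterm i
    rw [← Finset.mul_sum, Finset.sum_sub_distrib, Finset.sum_sub_distrib, hcard] at hs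
    nlinarith [hD0 ⟨k, hkn⟩]

theorem IsSVD.mul_transpose {n d : ℕ} {M S : Matrix (Fin n) (Fin d) ℝ}
    {U : Matrix (Fin n) (Fin n) ℝ} {V : Matrix (Fin d) (Fin d) ℝ} (h : IsSVD M U S V) :
    M * Mᵀ = U * Matrix.diagonal (fun i => ∑ j, S i j ^ 2) * Uᵀ := by
  have hV : Vᵀ * V = 1 := (mem_orthogonalGroup_iff' (Fin d) ℝ).1 h.orthogonal_right
  have hS : S * Sᵀ = Matrix.diagonal (fun i => ∑ j, S i j ^ 2) := by
    ext i i'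
    rw [mul_apply, diagonal_apply]
    split_ifs with hi
    · subst hi; simp [sq]
    · refine Finset.sum_eq_zero fun j _ => ?_
      rw [transpose_apply]
      by_cases hij : (i : ℕ) = j
      · rw [h.diagonal i' j (fun h' => hi (Fin.ext (hij.trans h'.symm))), mul_zero]
      · rw [h.diagonal i j hij, zero_mul]
  rw [← hS, h.eq_mul]
  calc _ = U * (S * (Vᵀ * V) * Sᵀ) * Uᵀ := by
        simp only [transpose_mul, transpose_transpose, Matrix.mul_assoc]
    _ = _ := by rw [hV, Matrix.mul_one]

theorem IsSVD.antitone_sum_sq {n d : ℕ} {M S : Matrix (Fin n) (Fin d) ℝ}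
    {U : Matrix (Fin n) (Fin n) ℝ} {V : Matrix (Fin d) (Fin d) ℝ} (h : IsSVD M U S V) :
    Antitone fun i => ∑ j, S i j ^ 2 := by
  have key : ∀ (i : Fin n) (j : Fin d), (i : ℕ) = j → ∑ j', S i j' ^ 2 = S i j ^ 2 := by
    intro i j hij
    refine Finset.sum_eq_single j (fun j' _ hj' => ?_) (by simp)
    rw [h.diagonal i j' (fun h' => hj' (Fin.ext (h'.symm.trans hij)))]
    simp
  intro i i' hii
  change ∑ j, S i' j ^ 2 ≤ ∑ j, S i j ^ 2
  by_cases hd : (i' : ℕ) < d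
  · have hd' : (i : ℕ) < d := lt_of_le_of_lt hii hd
    rw [key i' ⟨i', hd⟩ rfl, key i ⟨i, hd'⟩ rfl]
    exact pow_le_pow_left₀ (h.nonneg _ _ rfl) (h.antitone _ _ _ _ rfl rfl hii) 2
  · have : ∑ j, S i' j ^ 2 = 0 := by
      refine Finset.sum_eq_zero fun j _ => ?_
      rw [h.diagonal i' j (fun h' => hd (h' ▸ j.2))]
      simp
    rw [this]
    positivity

/-- The Eckart–Young theorem in Frobenius norm. -/
theorem IsSVDApprox.norm_sub_sq_le {n d k : ℕ} {M B : Matrix (Fin n) (Fin d) ℝ}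
    (hB : IsSVDApprox k M B) (X : Matrix (Fin n) (Fin d) ℝ) (hX : X.rank ≤ k) :
    ‖M - B‖ ^ 2 ≤ ‖M - X‖ ^ 2 := by
  obtain ⟨U, S, V, h, rfl⟩ := hB
  have hU : Uᵀ * U = 1 := (mem_orthogonalGroup_iff' (Fin n) ℝ).1 h.orthogonal_left
  have hU' : U * Uᵀ = 1 := (mem_orthogonalGroup_iff (Fin n) ℝ).1 h.orthogonal_left
  have hV : Vᵀ * V = 1 := (mem_orthogonalGroup_iff' (Fin d) ℝ).1 h.orthogonal_right
  -- Replacing `X` by `R * M`, with `R` the projection onto its columns, only lowers the error and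
  -- turns the claim into Ky Fan's bound.
  obtain ⟨R, hR, hRk, hRX⟩ := exists_isOrthProj_range X
  have h1 : ‖M - U * truncate k S * Vᵀ‖ ^ 2 =
      ∑ i : Fin n, ∑ j, S i j ^ 2 - ∑ i : Fin n, if (i : ℕ) < k then ∑ j, S i j ^ 2 else 0 := by
    have : M - U * truncate k S * Vᵀ = U * (S - truncate k S) * Vᵀ := by
      conv_lhs => rw [h.eq_mul]
      rw [Matrix.mul_sub, Matrix.sub_mul]
    rw [this, frobenius_norm_sq_orthogonal_mul hU hV, frobenius_norm_sq,
      ← Finset.sum_sub_distrib]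
    refine Finset.sum_congr rfl fun i _ => ?_
    split_ifs with hi <;> simp [truncate, hi]
  have h2 : (M * Mᵀ).trace = ∑ i : Fin n, ∑ j, S i j ^ 2 := by
    rw [← frobenius_norm_sq_eq_trace, h.eq_mul, frobenius_norm_sq_orthogonal_mul hU hV,
      frobenius_norm_sq]
  have h3 := ky_fan_trace_le hU' h.antitone_sum_sq (fun i => by positivity) hR (hRk.trans hX)
  rw [← h.mul_transpose] at h3
  rw [hR.pythagoras M X hRX, hR.norm_sub_mul_sq, h1, h2]
  nlinarith [sq_nonneg ‖R * M - X‖]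

theorem rank_truncate_le {n d : ℕ} (k : ℕ) (S : Matrix (Fin n) (Fin d) ℝ) :
    (truncate k S).rank ≤ k := by
  classical
  have hE : IsOrthProj (diagonal fun i : Fin n => if (i : ℕ) < k then (1 : ℝ) else 0) :=
    ⟨by simp, by simp [diagonal_mul_diagonal]⟩
  have e : truncate k S = (diagonal fun i : Fin n => if (i : ℕ) < k then (1 : ℝ) else 0) * S := by
    ext i j; simp [truncate, diagonal_mul]
  rw [e]
  refine (rank_mul_le_left _ _).trans ?_
  rw [rank_diagonal, Fintype.card_subtype]
  calc _ ≤ ((Finset.univ.filter fun i : Fin n => (i : ℕ) < k).image Fin.val).card := by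
        rw [Finset.card_image_of_injective _ Fin.val_injective]
        exact Finset.card_le_card fun i hi => by simpa using hi
    _ ≤ (Finset.range k).card := Finset.card_le_card fun i hi => by
        obtain ⟨j, hj, rfl⟩ := Finset.mem_image.1 hi
        simpa using hj
    _ = k := Finset.card_range k

theorem IsSVDApprox.rank_le {n d k : ℕ} {M B : Matrix (Fin n) (Fin d) ℝ}
    (hB : IsSVDApprox k M B) : B.rank ≤ k := by
  obtain ⟨U, S, V, -, rfl⟩ := hB
  exact (rank_mul_le_left _ _).trans ((rank_mul_le_right _ _).trans (rank_truncate_le k S))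

/-- Truncation is right multiplication by the projection onto the leading right singular vectors, so
it does not leave the column space of `M`. -/
theorem IsSVDApprox.exists_eq_mul {n d k : ℕ} {M B : Matrix (Fin n) (Fin d) ℝ}
    (hB : IsSVDApprox k M B) : ∃ Z : Matrix (Fin d) (Fin d) ℝ, B = M * Z := by
  obtain ⟨U, S, V, h, rfl⟩ := hB
  have hV : Vᵀ * V = 1 := (mem_orthogonalGroup_iff' (Fin d) ℝ).1 h.orthogonal_right
  have e : truncate k S = S * Matrix.diagonal fun j : Fin d => if (j : ℕ) < k then (1 : ℝ) else 0 := by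
    ext i j
    rw [mul_diagonal]
    by_cases hij : (i : ℕ) = j
    · simp [truncate, hij]
    · simp [truncate, h.diagonal i j hij]
  refine ⟨V * (Matrix.diagonal fun j : Fin d => if (j : ℕ) < k then (1 : ℝ) else 0) * Vᵀ, ?_⟩
  rw [e, h.eq_mul]
  generalize (Matrix.diagonal fun j : Fin d => if (j : ℕ) < k then (1 : ℝ) else 0) = E
  calc U * (S * E) * Vᵀ = U * S * (1 : Matrix (Fin d) (Fin d) ℝ) * E * Vᵀ := by
        simp only [Matrix.mul_assoc, Matrix.one_mul]
    _ = U * S * Vᵀ * (V * E * Vᵀ) := by rw [← hV]; simp only [Matrix.mul_assoc]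

/-- An eigendecomposition of a Gram matrix with the eigenvalues in non-increasing order. -/
theorem exists_sorted_eigendecomposition {n : ℕ} {ι : Type*} [Fintype ι]
    (C : Matrix (Fin n) ι ℝ) :
    ∃ (U : Matrix (Fin n) (Fin n) ℝ) (D : Fin n → ℝ), Uᵀ * U = 1 ∧ U * Uᵀ = 1 ∧ Antitone D ∧
      (∀ i, 0 ≤ D i) ∧ C * Cᵀ = U * diagonal D * Uᵀ := by
  have hP : (C * Cᵀ).PosSemidef := by
    simpa using posSemidef_self_mul_conjTranspose C
  have hG := hP.isHermitian
  set W : Matrix (Fin n) (Fin n) ℝ := ↑hG.eigenvectorUnitary with hWdef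
  set l := hG.eigenvalues with hl
  have hW : Wᵀ * W = 1 := by
    have := (mem_unitaryGroup_iff' (A := W)).1 hG.eigenvectorUnitary.2
    simpa [star_eq_conjTranspose] using this
  have hs : C * Cᵀ = W * diagonal l * Wᵀ := by
    have := hG.spectral_theorem
    rw [Unitary.conjStarAlgAut_apply] at this
    simpa [star_eq_conjTranspose, Function.comp_def] using this
  let σ : Equiv.Perm (Fin n) := Tuple.sort fun i => -l i
  have hσ : Monotone ((fun i => -l i) ∘ σ) := Tuple.monotone_sort fun i => -l i
  have hU : (W.submatrix id σ)ᵀ * W.submatrix id σ = 1 := by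
    rw [transpose_submatrix, ← submatrix_mul _ _ _ _ _ Function.bijective_id, hW]
    exact submatrix_one_equiv σ
  refine ⟨W.submatrix id σ, l ∘ σ, hU, mul_eq_one_comm.1 hU,
    fun i j hij => neg_le_neg_iff.1 (hσ hij), fun i => hP.eigenvalues_nonneg _, ?_⟩
  have : diagonal (l ∘ σ) = (diagonal l).submatrix σ σ := by
    rw [submatrix_diagonal_equiv]
  rw [this, transpose_submatrix, submatrix_mul_equiv, submatrix_mul_equiv, hs, submatrix_id_id]

/-- Among the projections of rank at most `k`, some projection onto a subspace of the column space
of `C` captures most of `C`. -/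
theorem exists_isOrthProj_isMax {n : ℕ} (k : ℕ) {ι : Type*} [Fintype ι]
    (C : Matrix (Fin n) ι ℝ) :
    ∃ Q : Matrix (Fin n) (Fin n) ℝ, IsOrthProj Q ∧ Q.rank ≤ k ∧
      (∃ Y : Matrix ι (Fin n) ℝ, Q = C * Y) ∧
      ∀ R : Matrix (Fin n) (Fin n) ℝ, IsOrthProj R → R.rank ≤ k →
        ‖C - Q * C‖ ^ 2 ≤ ‖C - R * C‖ ^ 2 := by
  obtain ⟨U, D, hU, hU', hD, hD0, hG⟩ := exists_sorted_eigendecomposition C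
  have key : ∀ a b : Fin n → ℝ, (U * diagonal a * Uᵀ) * (U * diagonal b * Uᵀ) =
      U * diagonal (fun i => a i * b i) * Uᵀ := by
    intro a b
    rw [← diagonal_mul_diagonal]
    calc _ = U * diagonal a * (Uᵀ * U) * diagonal b * Uᵀ := by simp only [Matrix.mul_assoc]
      _ = _ := by rw [hU]; simp only [Matrix.mul_assoc, Matrix.mul_one]
  -- Since `0⁻¹ = 0`, `w i` is 1 when `i < k` and `D i ≠ 0`, and 0 otherwise. Omitting null
  -- directions lets the projection factor through `C * Cᵀ`.
  let w : Fin n → ℝ := fun i => D i * if (i : ℕ) < k then (D i)⁻¹ else 0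
  have hw : ∀ i, w i * D i = if (i : ℕ) < k then D i else 0 := by
    intro i
    by_cases h : D i = 0
    · simp [h]
    · by_cases hi : (i : ℕ) < k <;> simp [w, h, hi]
  have hww : ∀ i, w i * w i = w i := by
    intro i
    by_cases h : D i = 0
    · simp [w, h]
    · by_cases hi : (i : ℕ) < k <;> simp [w, h, hi]
  have hQ : IsOrthProj (U * diagonal w * Uᵀ) :=
    ⟨by simp [transpose_mul, Matrix.mul_assoc], by rw [key]; simp only [hww]⟩
  refine ⟨U * diagonal w * Uᵀ, hQ, ?_, ?_, ?_⟩
  · have : diagonal w = truncate k (diagonal w) := by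
      ext i j
      by_cases hi : (i : ℕ) < k <;> simp [truncate, hi, diagonal_apply, w]
    refine (rank_mul_le_left _ _).trans ((rank_mul_le_right _ _).trans ?_)
    rw [this]
    exact rank_truncate_le k _
  · refine ⟨Cᵀ * (U * diagonal (fun i : Fin n => if (i : ℕ) < k then (D i)⁻¹ else 0) * Uᵀ), ?_⟩
    rw [← Matrix.mul_assoc, hG, key]
  · intro R hR hRk
    rw [hQ.norm_sub_mul_sq, hR.norm_sub_mul_sq]
    have h1 := ky_fan_trace_le hU' hD hD0 hR hRk
    rw [← hG] at h1
    have h2 : (U * diagonal w * Uᵀ * (C * Cᵀ)).trace =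
        ∑ i : Fin n, if (i : ℕ) < k then D i else 0 := by
      rw [hG, key, trace_mul_comm, ← Matrix.mul_assoc, hU, Matrix.one_mul, trace_diagonal]
      exact Finset.sum_congr rfl fun i _ => hw i
    linarith

/-! ### Ridge leverage scores -/

section Ridge

variable {n d : ℕ} (A : Matrix (Fin n) (Fin d) ℝ)

theorem dotProduct_ridge_mulVec (lam : ℝ) (x : Fin n → ℝ) :
    x ⬝ᵥ ((A * Aᵀ + lam • (1 : Matrix (Fin n) (Fin n) ℝ)) *ᵥ x) =
      ∑ i, (x ⬝ᵥ A.col i) ^ 2 + lam * (x ⬝ᵥ x) := by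
  rw [add_mulVec, dotProduct_add, smul_mulVec, one_mulVec, dotProduct_smul, smul_eq_mul,
    ← mulVec_mulVec, dotProduct_mulVec]
  congr 1
  rw [mulVec_transpose, dotProduct]
  exact Finset.sum_congr rfl fun i _ => (sq _).symm

theorem isHermitian_ridge (lam : ℝ) :
    (A * Aᵀ + lam • (1 : Matrix (Fin n) (Fin n) ℝ))ᵀ =
      A * Aᵀ + lam • (1 : Matrix (Fin n) (Fin n) ℝ) := by
  simp

/-- For `lam = 0` the ridge matrix `K` may be singular. With `N = 1 - K K⁺`, the trace of `N K Nᵀ =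
0` is `‖N A‖² + lam ‖N‖²`, which forces `N A = 0`. -/
theorem ridge_mul_pinv_mul {lam : ℝ} (hlam : 0 ≤ lam) :
    (A * Aᵀ + lam • (1 : Matrix (Fin n) (Fin n) ℝ)) *
      pinv (A * Aᵀ + lam • (1 : Matrix (Fin n) (Fin n) ℝ)) * A = A := by
  set K := A * Aᵀ + lam • (1 : Matrix (Fin n) (Fin n) ℝ) with hK
  have hR := (pinv_spec K).isOrthProj
  have hRK := (pinv_spec K).mul_mul_self
  set R := K * pinv K
  have h0 : (1 - R) * K = 0 := by rw [Matrix.sub_mul, hRK, Matrix.one_mul, sub_self]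
  have h1 : ((1 - R) * A) * ((1 - R) * A)ᵀ + lam • ((1 - R) * (1 - R)ᵀ) = 0 := by
    calc _ = (1 - R) * K * (1 - R)ᵀ := by
          rw [hK, transpose_mul]
          simp only [Matrix.mul_add, Matrix.add_mul, Matrix.mul_smul, Matrix.smul_mul,
            Matrix.mul_one, Matrix.mul_assoc]
      _ = 0 := by rw [h0, Matrix.zero_mul]
  have h2 := congrArg trace h1
  rw [trace_add, trace_smul, ← frobenius_norm_sq_eq_trace, ← frobenius_norm_sq_eq_trace,
    trace_zero, smul_eq_mul] at h2
  have h3 : ‖(1 - R) * A‖ ^ 2 = 0 := by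
    nlinarith [sq_nonneg ‖(1 - R) * A‖, mul_nonneg hlam (sq_nonneg ‖1 - R‖)]
  have h4 : (1 - R) * A = 0 := by simpa using h3
  rw [Matrix.sub_mul, Matrix.one_mul, sub_eq_zero] at h4
  exact h4.symm

/-- The witness `b = K⁺ a_i` turns the score into a value of the quadratic form of `K`, so the
pseudoinverse drops out of later estimates. -/
theorem exists_ridge_mulVec_eq_col {lam : ℝ} (hlam : 0 ≤ lam) (i : Fin d) :
    ∃ b : Fin n → ℝ,
      (A * Aᵀ + lam • (1 : Matrix (Fin n) (Fin n) ℝ)) *ᵥ b = A.col i ∧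
      ridgeLeverageScore A lam i =
        b ⬝ᵥ ((A * Aᵀ + lam • (1 : Matrix (Fin n) (Fin n) ℝ)) *ᵥ b) := by
  have hKA := ridge_mul_pinv_mul A hlam
  have hT := isHermitian_ridge A lam
  rw [ridgeLeverageScore]
  set K := A * Aᵀ + lam • (1 : Matrix (Fin n) (Fin n) ℝ)
  have h1 : K *ᵥ (pinv K *ᵥ A.col i) = A.col i := by
    rw [mulVec_mulVec]
    conv_rhs => rw [← hKA]
    rfl
  exact ⟨pinv K *ᵥ A.col i, h1, by rw [h1, dotProduct_comm]⟩

theorem ridge_form_nonneg {lam : ℝ} (hlam : 0 ≤ lam) (x : Fin n → ℝ) :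
    0 ≤ x ⬝ᵥ ((A * Aᵀ + lam • (1 : Matrix (Fin n) (Fin n) ℝ)) *ᵥ x) := by
  rw [dotProduct_ridge_mulVec]
  have : 0 ≤ x ⬝ᵥ x := Finset.sum_nonneg fun i _ => mul_self_nonneg _
  positivity

theorem ridgeLeverageScore_nonneg {lam : ℝ} (hlam : 0 ≤ lam) (i : Fin d) :
    0 ≤ ridgeLeverageScore A lam i := by
  obtain ⟨b, -, hb⟩ := exists_ridge_mulVec_eq_col A hlam i
  rw [hb]
  exact ridge_form_nonneg A hlam b

/-- Ridge leverage scores bound the relative contribution of a column to the ridge form. -/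
theorem sq_dotProduct_col_le {lam : ℝ} (hlam : 0 ≤ lam) (i : Fin d) (x : Fin n → ℝ) :
    (x ⬝ᵥ A.col i) ^ 2 ≤
      x ⬝ᵥ ((A * Aᵀ + lam • (1 : Matrix (Fin n) (Fin n) ℝ)) *ᵥ x) *
        ridgeLeverageScore A lam i := by
  obtain ⟨b, hb, hτ⟩ := exists_ridge_mulVec_eq_col A hlam i
  have hpos := ridge_form_nonneg A hlam
  have hT := isHermitian_ridge A lam
  rw [hτ, ← hb]
  set K := A * Aᵀ + lam • (1 : Matrix (Fin n) (Fin n) ℝ)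
  have hsymm : b ⬝ᵥ (K *ᵥ x) = x ⬝ᵥ (K *ᵥ b) := by
    rw [dotProduct_mulVec, ← mulVec_transpose, hT, dotProduct_comm]
  -- Cauchy–Schwarz for the semidefinite form `K`: the form at `t • x + b` is a nonnegative
  -- quadratic in `t`, so its discriminant is nonpositive.
  have hquad : ∀ t : ℝ, 0 ≤ x ⬝ᵥ (K *ᵥ x) * (t * t) + 2 * (x ⬝ᵥ (K *ᵥ b)) * t +
      b ⬝ᵥ (K *ᵥ b) := by
    intro t
    have := hpos (t • x + b)
    simp only [mulVec_add, mulVec_smul, add_dotProduct, dotProduct_add, smul_dotProduct,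
      dotProduct_smul, smul_eq_mul, hsymm] at this
    linarith
  have := discrim_le_zero hquad
  rw [discrim] at this
  linarith

end Ridge

/-! ### The deterministic selection -/

theorem firstIndices_mono {d : ℕ} (π : Equiv.Perm (Fin d)) : Monotone (firstIndices π) := by
  intro l m hlm
  refine Finset.image_subset_image fun j hj => ?_
  simp only [Finset.mem_filter, Finset.mem_univ, true_and] at hj ⊢
  omega

/-- Padding the selection up to `k` indices can only shrink the discarded sum, because scores are
nonnegative. -/
theorem IsSelection.sum_compl_lt {d : ℕ} {τ : Fin d → ℝ} (hτ : ∀ i, 0 ≤ τ i) {k : ℕ} {ε : ℝ}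
    {Θ : Finset (Fin d)} (h : IsSelection τ k ε Θ) : ∑ i ∈ Θᶜ, τ i < ε := by
  obtain ⟨π, m, -, hm, rfl⟩ := h
  have h1 : ∑ i ∈ firstIndices π m, τ i > ∑ i, τ i - ε := hm.1
  have h2 : ∑ i ∈ firstIndices π m, τ i ≤ ∑ i ∈ firstIndices π (max m k), τ i :=
    Finset.sum_le_sum_of_subset_of_nonneg (firstIndices_mono π (le_max_left m k))
      fun i _ _ => hτ i
  have h3 := Finset.sum_add_sum_compl (firstIndices π (max m k)) τ
  linarith

theorem norm_mul_selection_sq {n d : ℕ} (M : Matrix (Fin n) (Fin d) ℝ) (Θ : Finset (Fin d)) :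
    ‖M * selectionMatrix Θ‖ ^ 2 = ∑ i ∈ Θ, M.col i ⬝ᵥ M.col i := by
  have hcol : ∀ j : Θ, (M * selectionMatrix Θ).col j = M.col j := by
    intro j
    ext i
    simp [mul_apply, selectionMatrix]
  rw [frobenius_norm_sq_eq_sum_col, ← Finset.sum_coe_sort Θ]
  exact Finset.sum_congr rfl fun j _ => by rw [hcol]

/-! ### Error bound from the discarded scores -/

theorem dotProduct_sq_le {n : Type*} [Fintype n] (x y : n → ℝ) :
    (x ⬝ᵥ y) ^ 2 ≤ (x ⬝ᵥ x) * (y ⬝ᵥ y) := by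
  simpa [dotProduct, sq] using Finset.sum_mul_sq_le_sq_mul_sq Finset.univ x y

/-- If the discarded ridge leverage scores sum to at most `ε < 1 / 4` and the complement of the
projection `Q` captures at most `δ` of the selected columns, then it captures at most
`(1 + 4 * ε) * δ` of all the columns. -/
theorem norm_sub_mul_sq_le_of_selected {n d : ℕ} (A : Matrix (Fin n) (Fin d) ℝ) {lam δ ε : ℝ}
    (hlam : 0 ≤ lam) (hlamδ : lam ≤ δ) (hε : ε < 1 / 4) (Θ : Finset (Fin d))
    (hΘ : ∑ i ∈ Θᶜ, ridgeLeverageScore A lam i ≤ ε)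
    {Q : Matrix (Fin n) (Fin n) ℝ} (hQ : IsOrthProj Q)
    (hδ : ‖(A - Q * A) * selectionMatrix Θ‖ ^ 2 ≤ δ) :
    ‖A - Q * A‖ ^ 2 ≤ (1 + 4 * ε) * δ := by
  have hτ := ridgeLeverageScore_nonneg A hlam
  have hcs := sq_dotProduct_col_le A hlam
  have hform := dotProduct_ridge_mulVec A lam
  have hpos := ridge_form_nonneg A hlam
  set τ := ridgeLeverageScore A lam
  set K := A * Aᵀ + lam • (1 : Matrix (Fin n) (Fin n) ℝ)
  have hB : A - Q * A = (1 - Q) * A := by rw [Matrix.sub_mul, Matrix.one_mul]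
  rw [norm_mul_selection_sq] at hδ
  rw [frobenius_norm_sq_eq_sum_col, ← Finset.sum_add_sum_compl Θ]
  set v : Fin d → Fin n → ℝ := fun i => (A - Q * A).col i with hv
  have hvA : ∀ i, v i = (1 - Q) *ᵥ A.col i := fun i => by rw [hv, hB]; rfl
  have hdot : ∀ x, (1 - Q) *ᵥ x = x → ∀ i, x ⬝ᵥ A.col i = x ⬝ᵥ v i := by
    intro x hx i
    rw [hvA, dotProduct_mulVec, ← mulVec_transpose, hQ.one_sub.transpose_eq, hx]
  have hvfix : ∀ i, (1 - Q) *ᵥ v i = v i := fun i => by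
    rw [hvA, mulVec_mulVec, hQ.one_sub.mul_self]
  have hself : ∀ x : Fin n → ℝ, 0 ≤ x ⬝ᵥ x := fun x =>
    Finset.sum_nonneg fun i _ => mul_self_nonneg _
  -- The three pieces give `(1 - ε) xᵀ K x ≤ 2 δ |x|²`; `ε < 1/4` yields the constant `8/3`, relaxed
  -- to 4.
  have hbound : ∀ x, (1 - Q) *ᵥ x = x → x ⬝ᵥ (K *ᵥ x) ≤ 4 * δ * (x ⬝ᵥ x) := by
    intro x hx
    have h1 : ∑ i ∈ Θ, (x ⬝ᵥ A.col i) ^ 2 ≤ (x ⬝ᵥ x) * δ := by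
      calc _ ≤ ∑ i ∈ Θ, (x ⬝ᵥ x) * (v i ⬝ᵥ v i) := Finset.sum_le_sum fun i _ => by
            rw [hdot x hx]; exact dotProduct_sq_le _ _
        _ ≤ _ := by
            rw [← Finset.mul_sum]
            exact mul_le_mul_of_nonneg_left hδ (hself x)
    have h2 : ∑ i ∈ Θᶜ, (x ⬝ᵥ A.col i) ^ 2 ≤ x ⬝ᵥ (K *ᵥ x) * ε := by
      calc _ ≤ ∑ i ∈ Θᶜ, x ⬝ᵥ (K *ᵥ x) * τ i := Finset.sum_le_sum fun i _ => hcs i x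
        _ ≤ _ := by
            rw [← Finset.mul_sum]
            exact mul_le_mul_of_nonneg_left hΘ (hpos x)
    have h3 := hform x
    rw [← Finset.sum_add_sum_compl Θ] at h3
    have h4 := mul_le_mul_of_nonneg_right hlamδ (hself x)
    have h5 := mul_le_mul_of_nonneg_left hε.le (hpos x)
    have h6 := mul_nonneg (hlam.trans hlamδ) (hself x)
    linarith
  have hδ0 : 0 ≤ δ := hlam.trans hlamδ
  -- At `x = v i`, `x ⬝ a_i = |v i|²`, so `|v i|⁴ ≤ 4 δ |v i|² τ i`; one factor cancels unless `v i
  -- = 0`.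
  have hcol : ∀ i, v i ⬝ᵥ v i ≤ 4 * δ * τ i := by
    intro i
    have h1 := hcs i (v i)
    rw [hdot _ (hvfix i)] at h1
    have h2 := mul_le_mul_of_nonneg_right (hbound _ (hvfix i)) (hτ i)
    rcases (hself (v i)).eq_or_lt with h0 | h0
    · rw [← h0]
      have := hτ i
      positivity
    · refine le_of_mul_le_mul_left ?_ h0
      linarith
  have hrest : ∑ i ∈ Θᶜ, v i ⬝ᵥ v i ≤ 4 * δ * ε := by
    calc _ ≤ ∑ i ∈ Θᶜ, 4 * δ * τ i := Finset.sum_le_sum fun i _ => hcol i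
      _ ≤ _ := by
          rw [← Finset.mul_sum]
          exact mul_le_mul_of_nonneg_left hΘ (by positivity)
  change ∑ i ∈ Θ, v i ⬝ᵥ v i + ∑ i ∈ Θᶜ, v i ⬝ᵥ v i ≤ _
  change ∑ i ∈ Θ, v i ⬝ᵥ v i ≤ δ at hδ
  linarith

/-- The columns selected by their ridge leverage scores span a rank-`k` approximation of `A` that
is optimal up to the factor `1 + 4 * ε`. -/
theorem IsDRLS.exists_norm_sub_sq_le {n d k : ℕ} (hk : 1 ≤ k) {A Ak : Matrix (Fin n) (Fin d) ℝ}
    (hAk : Ak.rank ≤ k) {ε : ℝ} (hε : ε < 1 / 4) {Θ : Finset (Fin d)}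
    {C : Matrix (Fin n) Θ ℝ} (hC : IsDRLS A Ak k ε Θ C) :
    ∃ X : Matrix (Fin n) (Fin d) ℝ, X.rank ≤ k ∧ (∃ Y : Matrix Θ (Fin d) ℝ, X = C * Y) ∧
      ‖A - X‖ ^ 2 ≤ (1 + 4 * ε) * ‖A - Ak‖ ^ 2 := by
  obtain ⟨hsel, hCeq⟩ := hC
  have hk' : (1 : ℝ) ≤ k := by exact_mod_cast hk
  have hlam : 0 ≤ 1 / (k : ℝ) * ‖A - Ak‖ ^ 2 := by positivity
  have hlamδ : 1 / (k : ℝ) * ‖A - Ak‖ ^ 2 ≤ ‖A - Ak‖ ^ 2 :=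
    mul_le_of_le_one_left (sq_nonneg _) ((div_le_one (by positivity)).2 hk')
  obtain ⟨Q, hQ, hQk, ⟨Y, hY⟩, hmax⟩ := exists_isOrthProj_isMax k C
  obtain ⟨R, hR, hRk, hRA⟩ := exists_isOrthProj_range Ak
  refine ⟨Q * A, (rank_mul_le_left _ _).trans hQk, ⟨Y * A, by rw [hY, Matrix.mul_assoc]⟩, ?_⟩
  refine norm_sub_mul_sq_le_of_selected A hlam hlamδ hε Θ
    (hsel.sum_compl_lt (ridgeLeverageScore_nonneg A hlam)).le hQ ?_
  have hmul : ∀ T : Matrix (Fin n) (Fin n) ℝ, C - T * C = (A - T * A) * selectionMatrix Θ := by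
    intro T
    rw [hCeq, Matrix.sub_mul, Matrix.mul_assoc]
  -- Chain: optimality of `Q` on `C`, then restoring the discarded columns, then optimality of `R *
  -- A` among matrices with columns in the range of `R`.
  calc ‖(A - Q * A) * selectionMatrix Θ‖ ^ 2 ≤ ‖(A - R * A) * selectionMatrix Θ‖ ^ 2 := by
        rw [← hmul, ← hmul]
        exact hmax R hR (hRk.trans hAk)
    _ ≤ ‖A - R * A‖ ^ 2 := by
        rw [norm_mul_selection_sq, frobenius_norm_sq_eq_sum_col]
        exact Finset.sum_le_sum_of_subset_of_nonneg (Finset.subset_univ _)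
          fun i _ _ => Finset.sum_nonneg fun _ _ => mul_self_nonneg _
    _ ≤ ‖A - Ak‖ ^ 2 := by
        rw [hR.pythagoras A Ak hRA]
        exact le_add_of_nonneg_right (sq_nonneg _)

/-! ### Optimality within the column space -/

/-- For every `X` in the column space, Pythagoras splits off the same term `‖A - C C⁺ A‖²`;
Eckart–Young for `C C⁺ A` handles the remainder. -/
theorem IsSVDApprox.isBestApproxInColSpace {n d k : ℕ} {ι : Type*} [Fintype ι]
    {A P : Matrix (Fin n) (Fin d) ℝ} {C : Matrix (Fin n) ι ℝ}
    (hP : IsSVDApprox k (C * pinv C * A) P) : IsBestApproxInColSpace k C A P := by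
  have hR := (pinv_spec C).isOrthProj
  have hRC : ∀ X : Matrix (Fin n) (Fin d) ℝ, (∃ Y : Matrix ι (Fin d) ℝ, X = C * Y) →
      C * pinv C * X = X := by
    rintro X ⟨Y, rfl⟩
    rw [← Matrix.mul_assoc, (pinv_spec C).mul_mul_self]
  obtain ⟨Z, hZ⟩ := hP.exists_eq_mul
  have hPC : ∃ Y : Matrix ι (Fin d) ℝ, P = C * Y :=
    ⟨pinv C * A * Z, by rw [hZ]; simp only [Matrix.mul_assoc]⟩
  refine ⟨⟨hP.rank_le, hPC⟩, fun X hXk hX => ?_⟩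
  refine le_of_sq_le_sq ?_ (norm_nonneg _)
  rw [hR.pythagoras A P (hRC P hPC), hR.pythagoras A X (hRC X hX)]
  exact add_le_add_right (hP.norm_sub_sq_le X hXk) _

end DRLS

theorem theorem2 {n d k : ℕ} (hk : 1 ≤ k) (A : Matrix (Fin n) (Fin d) ℝ) (hrank : k ≤ A.rank)
    (Ak : Matrix (Fin n) (Fin d) ℝ) (hAk : DRLS.IsSVDApprox k A Ak)
    (ε : ℝ) (hε : 0 < ε) (hε' : ε < 1 / 4)
    (Θ : Finset (Fin d)) (C : Matrix (Fin n) Θ ℝ) (hC : DRLS.IsDRLS A Ak k ε Θ C)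
    (P : Matrix (Fin n) (Fin d) ℝ) (hP : DRLS.IsSVDApprox k (C * DRLS.pinv C * A) P) :
    DRLS.IsBestApproxInColSpace k C A P ∧
      ‖A - C * DRLS.pinv C * A‖ ^ 2 ≤ ‖A - P‖ ^ 2 ∧
      ‖A - P‖ ^ 2 ≤ (1 + 4 * ε) * ‖A - Ak‖ ^ 2 := by
  have hbest := hP.isBestApproxInColSpace
  refine ⟨hbest, ?_, ?_⟩
  · obtain ⟨Y, hY⟩ := hbest.1.2
    have hCP : C * DRLS.pinv C * P = P := by
      rw [hY, ← Matrix.mul_assoc, (DRLS.pinv_spec C).mul_mul_self]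
    rw [(DRLS.pinv_spec C).isOrthProj.pythagoras A P hCP]
    exact le_add_of_nonneg_right (sq_nonneg _)
  · obtain ⟨X, hXk, hXC, hX⟩ := hC.exists_norm_sub_sq_le hk hAk.rank_le hε'
    exact (pow_le_pow_left₀ (norm_nonneg _) (hbest.2 X hXk hXC) 2).trans hX
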